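/- Let $\mathcal W,\mathcal V$ be closed subspaces of $L^2(\mathbb R)$ (complex valued functions) with $L^2(\mathbb R)=\mathcal W\oplus\mathcal V^{\perp}$ (algebraic direct sum; equivalently $L^2(\mathbb R)=\mathcal V\oplus\mathcal W^{\perp}$), and let $\pi_{\mathcal W\mathcal V^\perp}$ and $\pi_{\mathcal V\mathcal W^\perp}$ denote the oblique projections onto $\mathcal W$ along $\mathcal V^\perp$ and onto $\mathcal V$ along $\mathcal W^\perp$. A sequence $\{f_k\}_{k\in\mathbb Z}\subset\mathcal W$ is a frame for $\mathcal W$ if there are constants $0<\alpha\le\beta<\infty$ with $\alpha\|f\|^2\le\sum_{k}|\langle f,f_k\rangle|^2\le\beta\|f\|^2$ for all $f\in\mathcal W$; its synthesis operator is $T_{\mathcal F}:\ell^2(\mathbb Z)\to L^2(\mathbb R)$, $T_{\mathcal F}c=\sum_k c_kf_k$, and its analysis operator is $T_{\mathcal F}^*f=(\langle f,f_k\rangle)_k$. For $\varepsilon\ge 0$, frames $\mathcal F=\{f_k\}$ for $\mathcal W$ and $\mathcal G=\{g_k\}$ for $\mathcal V$ are called $\varepsilon$-approximate oblique dual frames if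 $$\|\pi_{\mathcal W\mathcal V^\perp}-T_{\mathcal F}T_{\mathcal G}^*\|\le\varepsilon\quad\text{or}\quad\|\pi_{\mathcal V\mathcal W^\perp}-T_{\mathcal G}T_{\mathcal F}^*\|\le\varepsilon .$$ Write $T_kf(x)=f(x-k)$ for $k\in\mathbb Z$, let $\widehat f$ be the Fourier transform on $L^2(\mathbb R)$ given by $\widehat f(\gamma)=\int f(x)e^{-2\pi i x\gamma}\,dx$ on $L^1\cap L^2$, and put $\Phi(\gamma)=\sum_{k\in\mathbb Z}|\widehat\phi(\gamma+k)|^2$ for $\gamma\in[0,1]$. **Theorem.** Let $\phi,\phi_1\in L^2(\mathbb R)$ be such that $\{T_k\phi\}_{k\in\mathbb Z}$ is a frame for $\mathcal W$ and $\{T_k\phi_1\}_{k\in\mathbb Z}$ is a frame for $\mathcal V$. Let $0\le\varepsilon<1$, and let $\psi\in\mathcal V$ satisfy $\widehat\psi=H\widehat{\phi_1}$ a.e. on $\mathbb R$, where $H\in L^2(0,1)$ is extended to a $1$-periodic function on $\mathbb R$. If $\{T_k\phi\}_{k\in\mathbb Z}$ and $\{T_k\psi\}_{k\in\mathbb Z}$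 are $\varepsilon$-approximate oblique dual frames, then for a.e. $\gamma\in\{\gamma\in[0,1]:\Phi(\gamma)\ne0\}$ the series $\sum_{n\in\mathbb Z}\widehat\phi(\gamma+n)\overline{\widehat{\phi_1}(\gamma+n)}$ converges absolutely, its sum is nonzero, and $$\left|\overline{H(\gamma)}-\frac{1}{\sum_{n\in\mathbb Z}\widehat\phi(\gamma+n)\overline{\widehat{\phi_1}(\gamma+n)}}\right|\le\frac{\varepsilon}{\left|\sum_{n\in\mathbb Z}\widehat\phi(\gamma+n)\overline{\widehat{\phi_1}(\gamma+n)}\right|}.$$ -/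

import Mathlib

open MeasureTheory FourierTransform
open scoped InnerProductSpace ComplexConjugate

section Hilbert

variable {E : Type*} [NormedAddCommGroup E] [InnerProductSpace ℂ E]

/-- `f` is a Bessel sequence: `∑ k, |⟨x, f k⟩|² ≤ β ‖x‖²` for all `x`. -/
def IsBessel {ι : Type*} (f : ι → E) : Prop :=
  ∃ β : ℝ, ∀ x : E, Summable (fun k => ‖⟪f k, x⟫_ℂ‖ ^ 2) ∧
    ∑' k, ‖⟪f k, x⟫_ℂ‖ ^ 2 ≤ β * ‖x‖ ^ 2

/-- `f` is a frame for the subspace `W`: all `f k` lie in `W`, and there are `0 < α ≤ β` with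
`α ‖x‖² ≤ ∑ k, |⟨x, f k⟩|² ≤ β ‖x‖²` for all `x ∈ W`. -/
def IsFrameFor {ι : Type*} (W : Submodule ℂ E) (f : ι → E) : Prop :=
  (∀ k, f k ∈ W) ∧ ∃ α β : ℝ, 0 < α ∧ α ≤ β ∧ ∀ x ∈ W,
    Summable (fun k => ‖⟪f k, x⟫_ℂ‖ ^ 2) ∧
    α * ‖x‖ ^ 2 ≤ ∑' k, ‖⟪f k, x⟫_ℂ‖ ^ 2 ∧
    ∑' k, ‖⟪f k, x⟫_ℂ‖ ^ 2 ≤ β * ‖x‖ ^ 2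

theorem IsFrameFor.isBessel [CompleteSpace E] {ι : Type*} {W : Submodule ℂ E} {f : ι → E}
    (hf : IsFrameFor W f) (hW : IsClosed (W : Set E)) : IsBessel f := by
  obtain ⟨hmem, α, β, hα, hαβ, hb⟩ := hf
  have : CompleteSpace W := hW.completeSpace_coe
  refine ⟨β, fun x => ?_⟩
  have key : ∀ k, ⟪f k, x⟫_ℂ = ⟪f k, W.starProjection x⟫_ℂ := fun k => by
    rw [← Submodule.inner_starProjection_left_eq_right,
      Submodule.starProjection_eq_self_iff.2 (hmem k)]
  simp only [key]
  obtain ⟨h1, -, h3⟩ := hb _ (Submodule.starProjection_apply_mem W x)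
  refine ⟨h1, h3.trans ?_⟩
  have hβ : 0 ≤ β := hα.le.trans hαβ
  have := Submodule.norm_starProjection_apply_le W x
  gcongr

theorem IsBessel.memlp {ι : Type*} {f : ι → E} (hf : IsBessel f) (x : E) :
    Memℓp (fun k => ⟪f k, x⟫_ℂ) 2 := by
  obtain ⟨β, hβ⟩ := hf
  refine memℓp_gen ?_
  simpa using (hβ x).1

/-- The analysis operator `x ↦ (⟨x, f k⟩)_k`, from the Hilbert space to `ℓ²`. (The inner product
of Mathlib is linear in its second argument.) -/
noncomputable def analysisOp {ι : Type*} {f : ι → E} (hf : IsBessel f) :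
    E →L[ℂ] lp (fun _ : ι => ℂ) 2 :=
  LinearMap.mkContinuousOfExistsBound
    { toFun := fun x => ⟨fun k => ⟪f k, x⟫_ℂ, hf.memlp x⟩
      map_add' := fun x y => by
        ext k
        exact inner_add_right _ _ _
      map_smul' := fun c x => by
        ext k
        exact inner_smul_right _ _ _ }
    (by
      obtain ⟨β, hβ⟩ := id hf
      refine ⟨Real.sqrt (max β 0), fun x => ?_⟩
      refine le_of_sq_le_sq ?_ (by positivity)
      rw [mul_pow, Real.sq_sqrt (le_max_right _ _)]
      have h := lp.norm_rpow_eq_tsum (p := 2) (by norm_num)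
        (⟨fun k => ⟪f k, x⟫_ℂ, hf.memlp x⟩ : lp (fun _ : ι => ℂ) 2)
      simp only [ENNReal.toReal_ofNat, Real.rpow_ofNat] at h
      refine (h.le.trans (hβ x).2).trans ?_
      gcongr
      exact le_max_left _ _)

@[simp]
theorem analysisOp_apply {ι : Type*} {f : ι → E} (hf : IsBessel f) (x : E) (k : ι) :
    (analysisOp hf x : ι → ℂ) k = ⟪f k, x⟫_ℂ := rfl

/-- The synthesis operator `c ↦ ∑ k, c k • f k`, from `ℓ²` to the Hilbert space. It is the adjoint
of the analysis operator; see `hasSum_synthesisOp` for the series. -/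
noncomputable def synthesisOp [CompleteSpace E] {ι : Type*} {f : ι → E} (hf : IsBessel f) :
    lp (fun _ : ι => ℂ) 2 →L[ℂ] E :=
  ContinuousLinearMap.adjoint (analysisOp hf)

theorem hasSum_synthesisOp [CompleteSpace E] {ι : Type*} {f : ι → E} (hf : IsBessel f)
    (c : lp (fun _ : ι => ℂ) 2) : HasSum (fun k => (c : ι → ℂ) k • f k) (synthesisOp hf c) := by
  classical
  have h := (lp.hasSum_single (E := fun _ : ι => ℂ) (p := 2) (by norm_num) c).mapL
    (synthesisOp hf)
  convert h using 2 with k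
  refine ext_inner_right ℂ fun x => ?_
  rw [synthesisOp, ContinuousLinearMap.adjoint_inner_left, lp.inner_single_left]
  simp [inner_smul_left, mul_comm]

/-- The oblique projection onto `W` along `Vᗮ`. -/
noncomputable def obliqueProjection [CompleteSpace E] (W V : Submodule ℂ E)
    (hW : IsClosed (W : Set E)) (h : IsCompl W Vᗮ) : E →L[ℂ] E :=
  W.projectionL Vᗮ (Submodule.IsCompl.isTopCompl_of_isClosed h hW V.isClosed_orthogonal)

/-- The decomposition `E = W ⊕ Vᗮ` is symmetric in the closed subspaces `V` and `W`. -/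
theorem isCompl_orthogonal_symm [CompleteSpace E] {W V : Submodule ℂ E}
    (hW : IsClosed (W : Set E)) (hV : IsClosed (V : Set E)) (h : IsCompl W Vᗮ) :
    IsCompl V Wᗮ := by
  have htop := Submodule.IsCompl.isTopCompl_of_isClosed h hW V.isClosed_orthogonal
  have : CompleteSpace V := hV.completeSpace_coe
  set P := W.projectionL Vᗮ htop with hP
  have hPW : ∀ w ∈ W, P w = w := fun w hw => by
    exact Submodule.projectionL_apply_left htop ⟨w, hw⟩
  have hPV : ∀ u ∈ Vᗮ, P u = 0 := fun u hu => by
    exact Submodule.projectionL_apply_right htop ⟨u, hu⟩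
  refine ⟨?_, ?_⟩
  · rw [Submodule.disjoint_def]
    intro v hv hvW
    have hx : v ∈ (W ⊔ Vᗮ)ᗮ := by
      rw [← Submodule.inf_orthogonal]
      exact ⟨hvW, Submodule.le_orthogonal_orthogonal V hv⟩
    rwa [h.sup_eq_top, Submodule.top_orthogonal_eq_bot, Submodule.mem_bot] at hx
  · rw [codisjoint_iff, eq_top_iff]
    intro x _
    refine Submodule.mem_sup.2 ⟨ContinuousLinearMap.adjoint P x, ?_,
      x - ContinuousLinearMap.adjoint P x, ?_, by abel⟩
    · rw [← Submodule.orthogonal_orthogonal V, Submodule.mem_orthogonal]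
      intro u hu
      rw [ContinuousLinearMap.adjoint_inner_right, hPV u hu, inner_zero_left]
    · rw [Submodule.mem_orthogonal]
      intro w hw
      rw [inner_sub_right, ContinuousLinearMap.adjoint_inner_right, hPW w hw, sub_self]

/-- `f` and `g` are `ε`-approximate oblique dual frames with respect to the closed subspaces `W`
and `V` with `E = W ⊕ Vᗮ`: they are frames for `W` and for `V`, and the operator
`T_f T_g^*` is within `ε` of the oblique projection onto `W` along `Vᗮ`, or
`T_g T_f^*` is within `ε` of the oblique projection onto `V` along `Wᗮ`. -/
def IsApproxObliqueDual [CompleteSpace E] {ι : Type*} (W V : Submodule ℂ E)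
    (hW : IsClosed (W : Set E)) (hV : IsClosed (V : Set E)) (h : IsCompl W Vᗮ)
    (ε : ℝ) (f g : ι → E) : Prop :=
  ∃ (hf : IsFrameFor W f) (hg : IsFrameFor V g),
    ‖obliqueProjection W V hW h -
        synthesisOp (hf.isBessel hW) ∘L analysisOp (hg.isBessel hV)‖ ≤ ε ∨
    ‖obliqueProjection V W hV (isCompl_orthogonal_symm hW hV h) -
        synthesisOp (hg.isBessel hV) ∘L analysisOp (hf.isBessel hW)‖ ≤ ε

end Hilbert

/-- The complex Hilbert space `L²(ℝ)`. -/
abbrev L2R : Type := Lp (α := ℝ) ℂ 2 (volume : Measure ℝ)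

/-- The translate `T_k f (x) = f (x - k)`. -/
noncomputable def intTranslate (k : ℤ) (f : L2R) : L2R :=
  Lp.compMeasurePreserving (fun x : ℝ => x - (k : ℝ))
    (measurePreserving_sub_right volume (k : ℝ)) f

/-- `Φ(γ) = ∑ k, |φ̂(γ + k)|²`, with `φ̂` the Fourier transform on `L²(ℝ)` (kernel
`exp (-2πi x γ)`). -/
noncomputable def periodization (φ : L2R) (γ : ℝ) : ℝ :=
  ∑' k : ℤ, ‖(𝓕 φ : L2R) (γ + k)‖ ^ 2

/-- The bracket product `∑ n, φ̂(γ + n) conj (φ̂₁(γ + n))`. -/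
noncomputable def bracket (φ φ₁ : L2R) (γ : ℝ) : ℂ :=
  ∑' n : ℤ, (𝓕 φ : L2R) (γ + n) * conj ((𝓕 φ₁ : L2R) (γ + n))

/-! Write [f, g] for `bracket f g` and Φ for [φ, φ]. Unfolding Plancherel over integer cells gives
that ⟨f, g⟩ is the integral of [f, g] over a period. Translation by k multiplies the Fourier
transform by a character, so the numbers ⟨f, T_k g⟩ are Fourier coefficients of [f, g]. By Parseval,
T_φ T_ψ^* therefore has the quadratic form ∫ [f, ψ] conj [g, φ] (`inner_synthesisOp_analysisOp`).

Let s be the set where Φ ≠ 0 and |1 - [φ, ψ]| > ε. Take f̂ = 1_s φ̂, which lies in W, and ĝ = w φ̂,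
with w the phase of 1 - [φ, ψ] on s. Testing the operator bound on f and g gives ∫_s Φ |1 - [φ, ψ]|
≤ ε ∫_s Φ, so s is null (`ae_norm_one_sub_bracket_le`). Finally [φ, ψ] = conj H · [φ, φ₁]. As ε < 1,
the bracket [φ, φ₁] cannot vanish where Φ ≠ 0, and dividing by it gives the estimate. -/

/-- Lebesgue measure on the period `(0, 1]`. -/
noncomputable abbrev periodMeasure : Measure ℝ := volume.restrict (Set.Ioc (0 : ℝ) 1)

theorem ae_periodMeasure_comp_add_int {p : ℝ → Prop} (h : ∀ᵐ γ, p γ) :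
    ∀ᵐ γ ∂periodMeasure, ∀ n : ℤ, p (γ + n) := by
  refine ae_restrict_of_ae (ae_all_iff.2 fun n => ?_)
  exact (measurePreserving_add_right volume (n : ℝ)).quasiMeasurePreserving.ae h

/-! ### Unfolding an integral over the line into one period. -/

section Periodize

variable {F : ℝ → ℂ}

theorem tsum_lintegral_comp_add_int_lt_top (hF : Integrable F) :
    ∑' n : ℤ, ∫⁻ γ, ‖F (γ + n)‖ₑ ∂periodMeasure < ⊤ := by
  have hs := (hF.norm.hasSum_intervalIntegral_comp_add_int).summable
  have h : ∀ n : ℤ, ∫⁻ γ, ‖F (γ + n)‖ₑ ∂periodMeasure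
      = ENNReal.ofReal (∫ x in (0 : ℝ)..1, ‖F (x + n)‖) := fun n => by
    rw [intervalIntegral.integral_of_le zero_le_one,
      ofReal_integral_norm_eq_lintegral_enorm (hF.comp_add_right _).integrableOn]
  simp only [h]
  rw [← ENNReal.ofReal_tsum_of_nonneg _ hs]
  · exact ENNReal.ofReal_lt_top
  · exact fun n => intervalIntegral.integral_nonneg zero_le_one fun _ _ => norm_nonneg _

theorem aestronglyMeasurable_comp_add_int (hF : Integrable F) (n : ℤ) :
    AEStronglyMeasurable (fun γ => F (γ + n)) periodMeasure :=
  (hF.comp_add_right (n : ℝ)).aestronglyMeasurable.restrict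

theorem lintegral_tsum_comp_add_int_lt_top (hF : Integrable F) :
    ∫⁻ γ, ∑' n : ℤ, ‖F (γ + n)‖ₑ ∂periodMeasure < ⊤ := by
  rw [lintegral_tsum fun n => (aestronglyMeasurable_comp_add_int hF n).enorm]
  exact tsum_lintegral_comp_add_int_lt_top hF

theorem ae_summable_comp_add_int (hF : Integrable F) :
    ∀ᵐ γ ∂periodMeasure, Summable fun n : ℤ => F (γ + n) := by
  have hm : AEMeasurable (fun γ => ∑' n : ℤ, ‖F (γ + n)‖ₑ) periodMeasure :=
    AEMeasurable.tsum fun n => (aestronglyMeasurable_comp_add_int hF n).enorm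
  filter_upwards [ae_lt_top' hm (lintegral_tsum_comp_add_int_lt_top hF).ne] with γ hγ
  exact Summable.of_norm (tsum_enorm_ne_top_iff_summable_norm.1 hγ.ne)

theorem integrable_tsum_comp_add_int (hF : Integrable F) :
    Integrable (fun γ => ∑' n : ℤ, F (γ + n)) periodMeasure := by
  refine ⟨?_, ?_⟩
  · refine aestronglyMeasurable_of_tendsto_ae Filter.atTop
      (f := fun (s : Finset ℤ) γ => ∑ n ∈ s, F (γ + n)) (fun s => ?_) ?_
    · exact Finset.aestronglyMeasurable_fun_sum _ fun n _ => aestronglyMeasurable_comp_add_int hF n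
    · filter_upwards [ae_summable_comp_add_int hF] with γ hγ using hγ.hasSum
  · exact (lintegral_mono fun γ => enorm_tsum_le_tsum_enorm).trans_lt
      (lintegral_tsum_comp_add_int_lt_top hF)

theorem integral_eq_integral_tsum_comp_add_int (hF : Integrable F) :
    ∫ γ, F γ = ∫ γ, ∑' n : ℤ, F (γ + n) ∂periodMeasure := by
  rw [integral_tsum (fun n => aestronglyMeasurable_comp_add_int hF n)
    (tsum_lintegral_comp_add_int_lt_top hF).ne, ← hF.hasSum_intervalIntegral_comp_add_int.tsum_eq]
  simp only [intervalIntegral.integral_of_le zero_le_one]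

end Periodize

/-! ### The bracket as a fibrewise inner product. -/

section Bracket

theorem integrable_fourier_mul_conj (f g : L2R) :
    Integrable fun γ => (𝓕 f : L2R) γ * conj ((𝓕 g : L2R) γ) := by
  simpa only [RCLike.inner_apply] using L2.integrable_inner (𝕜 := ℂ) (𝓕 g : L2R) (𝓕 f : L2R)

theorem ae_summable_bracket (f g : L2R) : ∀ᵐ γ ∂periodMeasure,
    Summable fun n : ℤ => (𝓕 f : L2R) (γ + n) * conj ((𝓕 g : L2R) (γ + n)) :=
  ae_summable_comp_add_int (F := fun γ => (𝓕 f : L2R) γ * conj ((𝓕 g : L2R) γ))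
    (integrable_fourier_mul_conj f g)

theorem integrable_bracket (f g : L2R) : Integrable (bracket f g) periodMeasure :=
  integrable_tsum_comp_add_int (integrable_fourier_mul_conj f g)

theorem inner_eq_integral_bracket (f g : L2R) :
    ⟪g, f⟫_ℂ = ∫ γ, bracket f g γ ∂periodMeasure := by
  rw [← Lp.inner_fourier_eq, L2.inner_def]
  simp only [RCLike.inner_apply]
  exact integral_eq_integral_tsum_comp_add_int (integrable_fourier_mul_conj f g)

theorem bracket_self (f : L2R) (γ : ℝ) : bracket f f γ = (periodization f γ : ℂ) := by
  simp only [bracket, periodization, Complex.mul_conj', Complex.ofReal_tsum, Complex.ofReal_pow]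

theorem conj_bracket (f g : L2R) (γ : ℝ) : conj (bracket f g γ) = bracket g f γ := by
  simp only [bracket, Complex.conj_tsum, map_mul, Complex.conj_conj, mul_comm]

theorem periodization_nonneg (f : L2R) (γ : ℝ) : 0 ≤ periodization f γ :=
  tsum_nonneg fun _ => by positivity

theorem integrable_periodization (f : L2R) : Integrable (periodization f) periodMeasure := by
  have h := (integrable_bracket f f).re
  simpa only [bracket_self, RCLike.re_to_complex, Complex.ofReal_re] using h

theorem norm_sq_eq_integral_periodization (f : L2R) :
    ‖f‖ ^ 2 = ∫ γ, periodization f γ ∂periodMeasure := by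
  have h := inner_eq_integral_bracket f f
  simp only [bracket_self] at h
  rw [integral_complex_ofReal, inner_self_eq_norm_sq_to_K] at h
  apply Complex.ofReal_injective
  rw [← h]
  simp

theorem ae_summable_norm_sq (f : L2R) : ∀ᵐ γ ∂periodMeasure,
    Summable fun n : ℤ => ‖(𝓕 f : L2R) (γ + n)‖ ^ 2 := by
  filter_upwards [ae_summable_bracket f f] with γ hγ
  simp only [Complex.mul_conj'] at hγ
  exact_mod_cast hγ

theorem norm_bracket_sq_le (f g : L2R) : ∀ᵐ γ ∂periodMeasure,
    ‖bracket f g γ‖ ^ 2 ≤ periodization f γ * periodization g γ := by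
  filter_upwards [ae_summable_norm_sq f, ae_summable_norm_sq g] with γ hf hg
  obtain ⟨hs, hle⟩ := Real.summable_and_inner_le_Lp_mul_Lq_tsum_of_nonneg
    Real.HolderConjugate.two_two
    (fun n : ℤ => norm_nonneg ((𝓕 f : L2R) (γ + n))) (fun n => norm_nonneg ((𝓕 g : L2R) (γ + n)))
    (by simpa using hf) (by simpa using hg)
  simp only [Real.rpow_ofNat, ← Real.sqrt_eq_rpow] at hle
  have h1 : ‖bracket f g γ‖ ≤ √(periodization f γ) * √(periodization g γ) := by
    refine (norm_tsum_le_tsum_norm ?_).trans ?_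
    · simpa using hs
    · simpa [periodization] using hle
  calc ‖bracket f g γ‖ ^ 2 ≤ (√(periodization f γ) * √(periodization g γ)) ^ 2 := by gcongr
    _ = _ := by
      rw [mul_pow, Real.sq_sqrt (periodization_nonneg f γ), Real.sq_sqrt (periodization_nonneg g γ)]

/-- In general a bracket is only in L¹. Fibrewise Cauchy–Schwarz and a bound on one periodization
put it in L², as Parseval requires. -/
theorem memLp_bracket (f g : L2R) {C : ℝ} (hC : ∀ᵐ γ ∂periodMeasure, periodization g γ ≤ C) :
    MemLp (bracket f g) 2 periodMeasure := by
  rw [memLp_two_iff_integrable_sq_norm (integrable_bracket f g).aestronglyMeasurable]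
  refine ((integrable_periodization f).mul_const C).mono'
    ((integrable_bracket f g).aestronglyMeasurable.norm.pow 2) ?_
  filter_upwards [hC, norm_bracket_sq_le f g] with γ h1 h2
  rw [Real.norm_of_nonneg (by positivity)]
  exact h2.trans (mul_le_mul_of_nonneg_left h1 (periodization_nonneg f γ))

end Bracket

/-! ### Translations as characters, and Parseval on a period. -/

/-- Both sides are continuous in `f`, so Schwartz functions suffice by density; there the Fourier
integral can be shifted directly. -/
theorem fourier_intTranslate (k : ℤ) (f : L2R) : ((𝓕 (intTranslate k f) : L2R) : ℝ → ℂ) =ᵐ[volume]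
    fun γ => conj (fourier k (γ : UnitAddCircle)) * (𝓕 f : L2R) γ := by
  set u : ℝ → ℂ := fun γ => conj (fourier k (γ : UnitAddCircle)) with hu
  have hucont : Continuous u :=
    Complex.continuous_conj.comp ((fourier k).continuous.comp (AddCircle.continuous_mk' 1))
  have hun : ∀ γ, ‖u γ‖ = 1 := fun γ => by
    rw [hu, RCLike.norm_conj, fourier_apply, Circle.norm_coe]
  have hmem : ∀ g : L2R, MemLp (fun γ => u γ * g γ) 2 := fun g =>
    (Lp.memLp g).of_le (hucont.aestronglyMeasurable.mul (Lp.aestronglyMeasurable g))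
      (.of_forall fun γ => by simp [hun])
  let M : L2R →ₗᵢ[ℂ] L2R :=
    { toFun := fun g => (hmem g).toLp
      map_add' := fun g h => by
        rw [← MemLp.toLp_add]
        refine MemLp.toLp_congr _ _ ?_
        filter_upwards [Lp.coeFn_add g h] with γ hγ
        rw [hγ, Pi.add_apply, mul_add]
        rfl
      map_smul' := fun c g => by
        rw [RingHom.id_apply, ← MemLp.toLp_const_smul]
        refine MemLp.toLp_congr _ _ ?_
        filter_upwards [Lp.coeFn_smul c g] with γ hγ
        rw [hγ, Pi.smul_apply, Pi.smul_apply, smul_eq_mul, smul_eq_mul, mul_left_comm]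
      norm_map' := fun g => by
        simp only [LinearMap.coe_mk, AddHom.coe_mk, Lp.norm_def]
        congr 1
        refine eLpNorm_congr_norm_ae ?_
        filter_upwards [(hmem g).coeFn_toLp] with γ hγ
        simp [hγ, hun] }
  have key : (𝓕 (intTranslate k f) : L2R) = M (𝓕 f) := by
    refine DenseRange.induction_on (p := fun f : L2R => (𝓕 (intTranslate k f) : L2R) = M (𝓕 f))
      (SchwartzMap.denseRange_toLpCLM (p := 2) ENNReal.ofNat_ne_top) f ?_ fun s => ?_
    · refine isClosed_eq ?_ (M.continuous.comp (Lp.fourierTransformₗᵢ ℝ ℂ).continuous)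
      exact (Lp.fourierTransformₗᵢ ℝ ℂ).continuous.comp
        (Lp.isometry_compMeasurePreserving (measurePreserving_sub_right volume (k : ℝ))).continuous
    · have h1 : intTranslate k (s.toLp 2) = (s.compSubConstCLM ℂ (k : ℝ)).toLp 2 := by
        refine Lp.ext ?_
        have h3 := (measurePreserving_sub_right volume (k : ℝ)).quasiMeasurePreserving.ae
          (s.coeFn_toLp 2 volume)
        filter_upwards [Lp.coeFn_compMeasurePreserving (s.toLp 2)
          (measurePreserving_sub_right volume (k : ℝ)), h3,
          (s.compSubConstCLM ℂ (k : ℝ)).coeFn_toLp 2 volume] with x h4 h5 h6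
        rw [intTranslate, h4, h6, Function.comp_apply, h5]
        rfl
      rw [SchwartzMap.toLpCLM_apply, h1, SchwartzMap.toLp_fourier_eq, SchwartzMap.toLp_fourier_eq]
      refine Lp.ext ?_
      filter_upwards [(𝓕 s).coeFn_toLp 2 volume, (hmem ((𝓕 s).toLp 2)).coeFn_toLp,
        (𝓕 (s.compSubConstCLM ℂ (k : ℝ))).coeFn_toLp 2 volume] with γ h4 h5 h6
      rw [h6]
      refine Eq.trans ?_ h5.symm
      rw [h4, SchwartzMap.fourier_coe, SchwartzMap.fourier_coe]
      have h7 : (s.compSubConstCLM ℂ (k : ℝ) : ℝ → ℂ) = (s : ℝ → ℂ) ∘ fun x => x + -(k : ℝ) := by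
        ext x
        simp [sub_eq_add_neg]
      have h8 := congrFun (VectorFourier.fourierIntegral_comp_add_right Real.fourierChar volume
        (innerₗ ℝ) (s : ℝ → ℂ) (-(k : ℝ))) γ
      rw [h7]
      refine h8.trans ?_
      rw [Circle.smul_def, smul_eq_mul, hu]
      simp only [← fourier_neg]
      congr 1
      rw [fourier_coe_apply, Real.fourierChar_apply]
      congr 1
      simp
      ring
  rw [key]
  exact (hmem _).coeFn_toLp

/-- Parseval for the Fourier basis of the circle. The coefficients here pair with the character of
index k instead of -k, hence the reindexing by negation. -/
theorem hasSum_conj_mul_fourierCoeff {A B : ℝ → ℂ}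
    (hA : MemLp A 2 (volume.restrict (Set.Ioc (0 : ℝ) 1)))
    (hB : MemLp B 2 (volume.restrict (Set.Ioc (0 : ℝ) 1))) :
    HasSum (fun k : ℤ => conj (∫ γ in Set.Ioc (0 : ℝ) 1, fourier k (γ : UnitAddCircle) * A γ) *
        ∫ γ in Set.Ioc (0 : ℝ) 1, fourier k (γ : UnitAddCircle) * B γ)
      (∫ γ in Set.Ioc (0 : ℝ) 1, conj (A γ) * B γ) := by
  have key : ∀ {A : ℝ → ℂ} (hA : MemLp (AddCircle.liftIoc 1 0 A) 2 AddCircle.haarAddCircle) (k : ℤ),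
      fourierBasis.repr hA.toLp (-k)
        = ∫ γ in Set.Ioc (0 : ℝ) 1, fourier k (γ : UnitAddCircle) * A γ := fun {A} hA k => by
    rw [fourierBasis_repr, fourierCoeff_congr_ae hA.coeFn_toLp,
      fourierCoeff_eq_intervalIntegral _ _ 0, intervalIntegral.integral_of_le (by norm_num)]
    simp only [zero_add, neg_neg, div_one, one_smul, smul_eq_mul]
    refine setIntegral_congr_fun measurableSet_Ioc fun x hx => ?_
    rw [AddCircle.liftIoc_coe_apply (by simpa using hx)]
  have hA' : MemLp (AddCircle.liftIoc 1 0 A) 2 AddCircle.haarAddCircle :=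
    (MemLp.memLp_liftIoc (T := 1) (t := 0) (by simpa using hA)).haarAddCircle
  have hB' : MemLp (AddCircle.liftIoc 1 0 B) 2 AddCircle.haarAddCircle :=
    (MemLp.memLp_liftIoc (T := 1) (t := 0) (by simpa using hB)).haarAddCircle
  have h := (fourierBasis (T := 1)).hasSum_inner_mul_inner hA'.toLp hB'.toLp
  have h2 : ⟪hA'.toLp, hB'.toLp⟫_ℂ = ∫ γ in Set.Ioc (0 : ℝ) 1, conj (A γ) * B γ := by
    have : ∀ᵐ x ∂(AddCircle.haarAddCircle (T := 1)), ⟪hA'.toLp _ x, hB'.toLp _ x⟫_ℂ =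
        AddCircle.liftIoc 1 0 (fun γ => conj (A γ) * B γ) x := by
      filter_upwards [hA'.coeFn_toLp, hB'.coeFn_toLp] with x h1 h2
      rw [h1, h2, RCLike.inner_apply, mul_comm]
      rfl
    rw [L2.inner_def, integral_congr_ae this, AddCircle.integral_haarAddCircle,
      AddCircle.integral_liftIoc_eq_intervalIntegral,
      intervalIntegral.integral_of_le (by norm_num)]
    simp
  rw [← (Equiv.neg ℤ).hasSum_iff, h2] at h
  have h3 : ((fun i => ⟪hA'.toLp, fourierBasis i⟫_ℂ * ⟪fourierBasis i, hB'.toLp⟫_ℂ) ∘ Equiv.neg ℤ)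
      = fun k : ℤ => conj (∫ γ in Set.Ioc (0 : ℝ) 1, fourier k (γ : UnitAddCircle) * A γ) *
        ∫ γ in Set.Ioc (0 : ℝ) 1, fourier k (γ : UnitAddCircle) * B γ := by
    ext k
    rw [← key hA', ← key hB', fourierBasis.repr_apply_apply, fourierBasis.repr_apply_apply,
      inner_conj_symm]
    rfl
  rwa [h3] at h

/-! ### Periodic Fourier multipliers. -/

section Multiplier

/-- A periodic factor is constant on each fibre γ + ℤ. The exceptional null set does not depend on
`r`, so several `r` can be used at the same γ. -/
theorem bracket_of_fourier_eq_mul {u : ℝ → ℂ} (hu : Function.Periodic u 1) {f g : L2R}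
    (h : ((𝓕 g : L2R) : ℝ → ℂ) =ᵐ[volume] fun γ => u γ * (𝓕 f : L2R) γ) :
    ∀ᵐ γ ∂periodMeasure, ∀ r : L2R, bracket g r γ = u γ * bracket f r γ := by
  filter_upwards [ae_periodMeasure_comp_add_int h] with γ hγ r
  have h1 : ∀ n : ℤ, u (γ + n) = u γ := fun n => by simpa using hu.int_mul n γ
  simp only [bracket, hγ, h1, mul_assoc, tsum_mul_left]

theorem inner_intTranslate_left (k : ℤ) (f g : L2R) :
    ⟪intTranslate k g, f⟫_ℂ = ∫ γ in Set.Ioc (0 : ℝ) 1, fourier k (γ : UnitAddCircle) *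
      bracket f g γ := by
  rw [inner_eq_integral_bracket]
  have hper : Function.Periodic (fun γ : ℝ => conj (fourier k (γ : UnitAddCircle))) 1 := fun γ => by
    simp only [AddCircle.coe_add_period]
  refine integral_congr_ae ?_
  filter_upwards [bracket_of_fourier_eq_mul hper (fourier_intTranslate k g)] with γ hγ
  rw [← conj_bracket, hγ, map_mul, conj_bracket, Complex.conj_conj]

theorem exists_fourier_eq_mul {u : ℝ → ℂ} (hu : Measurable u) (hu1 : ∀ γ, ‖u γ‖ ≤ 1) (f : L2R) :
    ∃ g : L2R, ((𝓕 g : L2R) : ℝ → ℂ) =ᵐ[volume] fun γ => u γ * (𝓕 f : L2R) γ := by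
  have hmem : MemLp (fun γ => u γ * (𝓕 f : L2R) γ) 2 := by
    refine (Lp.memLp (𝓕 f : L2R)).of_le
      (hu.aestronglyMeasurable.mul (Lp.aestronglyMeasurable _)) (.of_forall fun γ => ?_)
    rw [norm_mul]
    exact mul_le_of_le_one_left (norm_nonneg _) (hu1 γ)
  refine ⟨𝓕⁻ hmem.toLp, ?_⟩
  rw [FourierTransform.fourier_fourierInv_eq]
  exact hmem.coeFn_toLp

/-- Only the values of `v` on the period matter. A measurable representative, cut off to keep the
bound 1 everywhere, is extended periodically through `Int.fract`; the endpoint 1, where `Int.fract`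
is 0, is null. -/
theorem exists_bracket_eq_mul {v : ℝ → ℂ} (hv : AEStronglyMeasurable v periodMeasure)
    (hv1 : ∀ γ, ‖v γ‖ ≤ 1) (f : L2R) :
    ∃ g : L2R, ∀ᵐ γ ∂periodMeasure, ∀ r : L2R, bracket g r γ = v γ * bracket f r γ := by
  classical
  set w := hv.mk v
  have hw : Measurable w := hv.stronglyMeasurable_mk.measurable
  set t : ℝ → ℂ := fun γ => if ‖w γ‖ ≤ 1 then w γ else 0
  have ht : Measurable t :=
    Measurable.ite (measurableSet_le hw.norm measurable_const) hw measurable_const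
  have ht1 : ∀ γ, ‖t γ‖ ≤ 1 := fun γ => by
    by_cases h : ‖w γ‖ ≤ 1 <;> simp [t, h]
  obtain ⟨g, hg⟩ := exists_fourier_eq_mul (ht.comp measurable_fract) (fun γ => ht1 _) f
  refine ⟨g, ?_⟩
  have hper : Function.Periodic (t ∘ Int.fract) 1 := fun γ => by simp
  have hne : ∀ᵐ γ ∂periodMeasure, γ ≠ 1 := ae_restrict_of_ae (Measure.ae_ne volume 1)
  filter_upwards [bracket_of_fourier_eq_mul hper hg, hv.ae_eq_mk, hne,
    ae_restrict_mem measurableSet_Ioc] with γ h1 h2 h3 h4 r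
  have h5 : Int.fract γ = γ := Int.fract_eq_self.2 ⟨h4.1.le, lt_of_le_of_ne h4.2 h3⟩
  have h6 : w γ = v γ := h2.symm
  rw [h1, Function.comp_apply, h5]
  simp [t, h6, hv1]

theorem periodization_of_bracket_eq_mul {c : ℂ} {f g : L2R} {γ : ℝ}
    (h : ∀ r : L2R, bracket g r γ = c * bracket f r γ) :
    periodization g γ = ‖c‖ ^ 2 * periodization f γ := by
  apply Complex.ofReal_injective
  rw [← bracket_self, h, ← conj_bracket, h, bracket_self]
  push_cast
  rw [← Complex.mul_conj', map_mul, Complex.conj_ofReal, mul_assoc]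

end Multiplier

/-! ### Bessel bounds, membership in W, and the operator estimate. -/

/-- Testing the Bessel inequality on ĝ = 1_s f̂ gives ∫_s Φ² ≤ C ∫_s Φ, with Φ the periodization of
`f`; this forces s to be null if Φ > C on s. The cut-off Φ < N makes [g, f] = 1_s Φ bounded, so that
Parseval applies before any bound on Φ is known. -/
theorem ae_periodization_le_of_isBessel {f : L2R} (hf : IsBessel fun k : ℤ => intTranslate k f) :
    ∃ C : ℝ, ∀ᵐ γ ∂periodMeasure, periodization f γ ≤ C := by
  obtain ⟨β, hβ⟩ := hf
  set C := max β 0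
  have hC0 : 0 ≤ C := le_max_right _ _
  have hΦ := (integrable_periodization f).aestronglyMeasurable.aemeasurable
  have key : ∀ N : ℕ, ∀ᵐ γ ∂periodMeasure, ¬ (C < periodization f γ ∧ periodization f γ < N) := by
    intro N
    set s : Set ℝ := {γ | C < periodization f γ ∧ periodization f γ < N} with hs
    have hsm : NullMeasurableSet s periodMeasure :=
      (nullMeasurableSet_lt aemeasurable_const hΦ).inter (nullMeasurableSet_lt hΦ aemeasurable_const)
    set v : ℝ → ℂ := s.indicator 1 with hv
    have hv1 : ∀ γ, ‖v γ‖ ≤ 1 := fun γ => by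
      by_cases h : γ ∈ s <;> simp [v, h]
    obtain ⟨g, hg⟩ := exists_bracket_eq_mul
      ((aestronglyMeasurable_const (b := (1 : ℂ))).indicator₀ hsm) hv1 f
    have hA : MemLp (bracket g f) 2 periodMeasure := by
      refine MemLp.of_bound (integrable_bracket g f).aestronglyMeasurable N ?_
      filter_upwards [hg] with γ hγ
      rw [hγ, bracket_self]
      by_cases h : γ ∈ s
      · simpa [h, abs_of_nonneg (periodization_nonneg f γ)] using h.2.le
      · simp [h]
    have hP := hasSum_conj_mul_fourierCoeff hA hA
    simp only [← inner_intTranslate_left, Complex.conj_mul'] at hP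
    have h1 : ∫ γ, ‖bracket g f γ‖ ^ 2 ∂periodMeasure ≤ C * ‖g‖ ^ 2 := by
      have h2 : ((∑' k : ℤ, ‖⟪intTranslate k f, g⟫_ℂ‖ ^ 2 : ℝ) : ℂ)
          = ((∫ γ, ‖bracket g f γ‖ ^ 2 ∂periodMeasure : ℝ) : ℂ) := by
        rw [← integral_complex_ofReal]
        push_cast
        exact hP.tsum_eq
      rw [← Complex.ofReal_injective h2]
      refine (hβ g).2.trans ?_
      gcongr
      exact le_max_left _ _
    rw [norm_sq_eq_integral_periodization, ← integral_const_mul, ← sub_nonpos,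
      ← integral_sub hA.integrable_norm_pow' ((integrable_periodization g).const_mul C)] at h1
    have heq : ∀ᵐ γ ∂periodMeasure, ‖bracket g f γ‖ ^ 2 - C * periodization g γ
        = s.indicator (fun γ => periodization f γ * (periodization f γ - C)) γ := by
      filter_upwards [hg] with γ hγ
      rw [periodization_of_bracket_eq_mul hγ, hγ, bracket_self]
      by_cases h : γ ∈ s
      · simp [h]
        ring
      · simp [h]
    have hpos : ∀ γ, 0 ≤ s.indicator (fun γ => periodization f γ * (periodization f γ - C)) γ :=
      fun γ => Set.indicator_nonneg
        (fun x hx => mul_nonneg (periodization_nonneg f x) (sub_nonneg.2 hx.1.le)) γ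
    have hint : Integrable (fun γ => ‖bracket g f γ‖ ^ 2 - C * periodization g γ) periodMeasure :=
      hA.integrable_norm_pow'.sub ((integrable_periodization g).const_mul C)
    rw [integral_congr_ae heq] at h1
    have h0 := (integral_eq_zero_iff_of_nonneg hpos (hint.congr heq)).1
      (le_antisymm h1 (integral_nonneg hpos))
    filter_upwards [h0] with γ hγ hmem
    have hmem' : γ ∈ s := hmem
    rw [Set.indicator_of_mem hmem'] at hγ
    have : 0 < periodization f γ * (periodization f γ - C) :=
      mul_pos (hC0.trans_lt hmem.1) (sub_pos.2 hmem.1)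
    exact this.ne' hγ
  refine ⟨C, ?_⟩
  filter_upwards [ae_all_iff.2 key] with γ hγ
  by_contra! hlt
  obtain ⟨N, hN⟩ := exists_nat_gt (periodization f γ)
  exact hγ N ⟨hlt, hN⟩

/-- If g is orthogonal to W, all Fourier coefficients of [g, φ] vanish, so [g, φ] = 0 a.e. and ⟨g,
f⟩ = ∫ v [φ, g] = 0. Closedness of W then gives f ∈ W. -/
theorem mem_of_bracket_eq_mul {W : Submodule ℂ L2R} (hW : IsClosed (W : Set L2R)) {φ : L2R}
    (hφ : ∀ k : ℤ, intTranslate k φ ∈ W) {C : ℝ}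
    (hC : ∀ᵐ γ ∂periodMeasure, periodization φ γ ≤ C) {v : ℝ → ℂ} {f : L2R}
    (hf : ∀ᵐ γ ∂periodMeasure, ∀ r : L2R, bracket f r γ = v γ * bracket φ r γ) : f ∈ W := by
  have : CompleteSpace W := hW.completeSpace_coe
  rw [← Submodule.orthogonal_orthogonal W, Submodule.mem_orthogonal]
  intro g hg
  have hA := memLp_bracket g φ hC
  have hP := hasSum_conj_mul_fourierCoeff hA hA
  simp only [← inner_intTranslate_left, Complex.conj_mul'] at hP
  have h0 : ∀ k : ℤ, ⟪intTranslate k φ, g⟫_ℂ = 0 := fun k =>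
    (Submodule.mem_orthogonal W g).1 hg _ (hφ k)
  simp only [h0, norm_zero, Complex.ofReal_zero, ne_eq, OfNat.ofNat_ne_zero, not_false_eq_true,
    zero_pow] at hP
  have h1 : ∫ γ, ‖bracket g φ γ‖ ^ 2 ∂periodMeasure = 0 := by
    apply Complex.ofReal_injective
    rw [← integral_complex_ofReal, Complex.ofReal_zero]
    push_cast
    exact hP.unique hasSum_zero
  rw [integral_eq_zero_iff_of_nonneg (fun _ => by positivity) hA.integrable_norm_pow'] at h1
  rw [inner_eq_integral_bracket]
  refine integral_eq_zero_of_ae ?_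
  filter_upwards [h1, hf] with γ h2 h3
  have h4 : bracket g φ γ = 0 := by simpa using h2
  rw [h3, ← conj_bracket, h4]
  simp

theorem inner_synthesisOp_analysisOp {φ ψ : L2R} (hφ : IsBessel fun k : ℤ => intTranslate k φ)
    (hψ : IsBessel fun k : ℤ => intTranslate k ψ) (f g : L2R)
    (hg : MemLp (bracket g φ) 2 periodMeasure) (hf : MemLp (bracket f ψ) 2 periodMeasure) :
    ⟪g, synthesisOp hφ (analysisOp hψ f)⟫_ℂ
      = ∫ γ, conj (bracket g φ γ) * bracket f ψ γ ∂periodMeasure := by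
  rw [synthesisOp, ContinuousLinearMap.adjoint_inner_right, lp.inner_eq_tsum,
    ← (hasSum_conj_mul_fourierCoeff hg hf).tsum_eq]
  refine tsum_congr fun k => ?_
  rw [analysisOp_apply, analysisOp_apply, inner_intTranslate_left, inner_intTranslate_left,
    RCLike.inner_apply, mul_comm]

/-- The operator is tested only on a vector of W, so `P` need only fix W; this lets the adjoint of
the other oblique projection play the same role. -/
theorem ae_norm_one_sub_bracket_le {W : Submodule ℂ L2R} (hW : IsClosed (W : Set L2R)) {φ ψ : L2R}
    (hφW : ∀ k : ℤ, intTranslate k φ ∈ W) (hφ : IsBessel fun k : ℤ => intTranslate k φ)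
    (hψ : IsBessel fun k : ℤ => intTranslate k ψ) {P : L2R →L[ℂ] L2R} (hP : ∀ w ∈ W, P w = w)
    {ε : ℝ} (hε : 0 ≤ ε) (h : ‖P - synthesisOp hφ ∘L analysisOp hψ‖ ≤ ε) :
    ∀ᵐ γ ∂periodMeasure, periodization φ γ ≠ 0 → ‖1 - bracket φ ψ γ‖ ≤ ε := by
  obtain ⟨C, hC⟩ := ae_periodization_le_of_isBessel hφ
  obtain ⟨D, hD⟩ := ae_periodization_le_of_isBessel hψ
  set z : ℝ → ℂ := fun γ => 1 - bracket φ ψ γ with hz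
  have hzm : AEMeasurable z periodMeasure :=
    aemeasurable_const.sub (integrable_bracket φ ψ).aestronglyMeasurable.aemeasurable
  set s : Set ℝ := {γ | ε < ‖z γ‖ ∧ periodization φ γ ≠ 0} with hs
  have hsm : NullMeasurableSet s periodMeasure :=
    (nullMeasurableSet_lt aemeasurable_const hzm.norm).inter
      (nullMeasurableSet_eq_fun (integrable_periodization φ).aestronglyMeasurable.aemeasurable
        aemeasurable_const).compl
  set v : ℝ → ℂ := s.indicator fun _ => 1 with hv
  -- The phase of `z`, so that conj w · z = |z| on `s`; being unimodular there, it gives `g` the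
  -- same norm as `f`.
  set w : ℝ → ℂ := s.indicator fun γ => z γ / ‖z γ‖ with hw
  have hv1 : ∀ γ, ‖v γ‖ ≤ 1 := fun γ => by by_cases hγ : γ ∈ s <;> simp [v, hγ]
  have hvw : ∀ γ, ‖w γ‖ = ‖v γ‖ := fun γ => by
    by_cases hγ : γ ∈ s
    · have : ‖z γ‖ ≠ 0 := (hε.trans_lt hγ.1).ne'
      simp [v, w, hγ, this]
    · simp [v, w, hγ]
  obtain ⟨f, hf⟩ := exists_bracket_eq_mul (aestronglyMeasurable_const.indicator₀ hsm) hv1 φ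
  obtain ⟨g, hg⟩ := exists_bracket_eq_mul (v := w)
    ((hzm.div (Complex.measurable_ofReal.comp_aemeasurable hzm.norm)).aestronglyMeasurable.indicator₀
      hsm) (fun γ => (hvw γ).trans_le (hv1 γ)) φ
  have hfW : f ∈ W := mem_of_bracket_eq_mul hW hφW hC hf
  have hgφ := memLp_bracket g φ hC
  have hfψ := memLp_bracket f ψ hD
  have hfg : ‖g‖ = ‖f‖ := by
    rw [← sq_eq_sq₀ (norm_nonneg _) (norm_nonneg _), norm_sq_eq_integral_periodization,
      norm_sq_eq_integral_periodization]
    refine integral_congr_ae ?_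
    filter_upwards [hf, hg] with γ h1 h2
    rw [periodization_of_bracket_eq_mul h1, periodization_of_bracket_eq_mul h2, hvw]
  have hprod : Integrable (fun γ => conj (bracket g φ γ) * bracket f ψ γ) periodMeasure :=
    hgφ.star.integrable_mul hfψ
  have hdiff := (integrable_bracket f g).sub hprod
  have heq : ∀ᵐ γ ∂periodMeasure, bracket f g γ - conj (bracket g φ γ) * bracket f ψ γ
      = ((s.indicator (fun γ => periodization φ γ * ‖z γ‖) γ : ℝ) : ℂ) := by
    filter_upwards [hf, hg] with γ h1 h2
    rw [h1, h1, ← conj_bracket, h2, bracket_self]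
    by_cases hγ : γ ∈ s
    · have h3 : (‖z γ‖ : ℂ) ≠ 0 := by exact_mod_cast (hε.trans_lt hγ.1).ne'
      have h4 : bracket φ ψ γ = 1 - z γ := by simp [z]
      simp only [w, Set.indicator_of_mem hγ, map_mul, map_div₀, Complex.conj_ofReal, h4]
      field_simp
      push_cast
      linear_combination (periodization φ γ : ℂ) * Complex.conj_mul' (z γ)
    · simp [w, hγ]
  have hindint : Integrable (s.indicator fun γ => periodization φ γ * ‖z γ‖) periodMeasure := by
    simpa using (hdiff.congr heq).re
  have hle : ∫ γ, s.indicator (fun γ => periodization φ γ * ‖z γ‖) γ ∂periodMeasure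
      ≤ ε * ‖f‖ ^ 2 := by
    have h1 : ⟪g, (P - synthesisOp hφ ∘L analysisOp hψ) f⟫_ℂ
        = ((∫ γ, s.indicator (fun γ => periodization φ γ * ‖z γ‖) γ ∂periodMeasure : ℝ) : ℂ) := by
      rw [sub_apply, ContinuousLinearMap.comp_apply, hP f hfW, inner_sub_right,
        inner_synthesisOp_analysisOp hφ hψ f g hgφ hfψ, inner_eq_integral_bracket,
        ← integral_sub (integrable_bracket f g) hprod, integral_congr_ae heq,
        integral_complex_ofReal]
    calc _ ≤ ‖((∫ γ, s.indicator (fun γ => periodization φ γ * ‖z γ‖) γ ∂periodMeasure : ℝ) : ℂ)‖ :=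
          by rw [Complex.norm_real]; exact le_abs_self _
      _ ≤ ‖g‖ * ‖(P - synthesisOp hφ ∘L analysisOp hψ) f‖ := h1 ▸ norm_inner_le_norm _ _
      _ ≤ ‖f‖ * (ε * ‖f‖) := by
        rw [hfg]
        gcongr
        exact ContinuousLinearMap.le_of_opNorm_le _ h f
      _ = ε * ‖f‖ ^ 2 := by ring
  -- Since ‖f‖² = ∫_s Φ, the bound says that the integral of Φ(|z| - ε) over `s` is at most 0, while
  -- the integrand is positive on `s`.
  have heq2 : ∀ᵐ γ ∂periodMeasure, s.indicator (fun γ => periodization φ γ * ‖z γ‖) γ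
      - ε * periodization f γ = s.indicator (fun γ => periodization φ γ * (‖z γ‖ - ε)) γ := by
    filter_upwards [hf] with γ h1
    rw [periodization_of_bracket_eq_mul h1]
    by_cases hγ : γ ∈ s
    · simp [hγ]
      ring
    · simp [hγ]
  have hint2 := (hindint.sub ((integrable_periodization f).const_mul ε)).congr heq2
  rw [norm_sq_eq_integral_periodization, ← integral_const_mul, ← sub_nonpos,
    ← integral_sub hindint ((integrable_periodization f).const_mul ε), integral_congr_ae heq2] at hle
  have hpos : ∀ γ, 0 ≤ s.indicator (fun γ => periodization φ γ * (‖z γ‖ - ε)) γ := fun γ =>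
    Set.indicator_nonneg
      (fun x hx => mul_nonneg (periodization_nonneg φ x) (sub_nonneg.2 hx.1.le)) γ
  filter_upwards [(integral_eq_zero_iff_of_nonneg hpos hint2).1
    (le_antisymm hle (integral_nonneg hpos))] with γ h0 hne
  by_contra! hlt
  have hmem : γ ∈ s := ⟨hlt, hne⟩
  rw [Set.indicator_of_mem hmem] at h0
  exact (mul_ne_zero hne (sub_pos.2 hlt).ne') h0

/-! ### Oblique projections and the conclusion. -/

theorem obliqueProjection_apply_of_mem {E : Type*} [NormedAddCommGroup E] [InnerProductSpace ℂ E]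
    [CompleteSpace E] {W V : Submodule ℂ E} (hW : IsClosed (W : Set E)) (h : IsCompl W Vᗮ)
    {w : E} (hw : w ∈ W) : obliqueProjection W V hW h w = w :=
  Submodule.projectionL_apply_left
    (Submodule.IsCompl.isTopCompl_of_isClosed h hW V.isClosed_orthogonal) ⟨w, hw⟩

/-- The adjoint of the projection onto `V` along `Wᗮ` is the identity on `W`. -/
theorem adjoint_obliqueProjection_apply_of_mem {E : Type*} [NormedAddCommGroup E]
    [InnerProductSpace ℂ E] [CompleteSpace E] {W V : Submodule ℂ E} (hV : IsClosed (V : Set E))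
    (h : IsCompl V Wᗮ) {w : E} (hw : w ∈ W) :
    ContinuousLinearMap.adjoint (obliqueProjection V W hV h) w = w := by
  refine ext_inner_left ℂ fun x => ?_
  rw [ContinuousLinearMap.adjoint_inner_right, ← sub_eq_zero, ← inner_sub_left]
  have htop := Submodule.IsCompl.isTopCompl_of_isClosed h hV W.isClosed_orthogonal
  obtain ⟨a, ha, b, hb, rfl⟩ := Submodule.mem_sup.1 (h.sup_eq_top ▸ Submodule.mem_top (x := x))
  have h1 : obliqueProjection V W hV h a = a := obliqueProjection_apply_of_mem hV h ha
  have h2 : obliqueProjection V W hV h b = 0 := Submodule.projectionL_apply_right htop ⟨b, hb⟩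
  rw [map_add, h1, h2, add_zero, sub_add_cancel_left, inner_neg_left,
    Submodule.inner_left_of_mem_orthogonal hw hb, neg_zero]

theorem mainTheorem4 (W V : Submodule ℂ L2R)
    (hW : IsClosed (W : Set L2R)) (hV : IsClosed (V : Set L2R)) (hWV : IsCompl W Vᗮ)
    (φ φ₁ : L2R)
    (hφ : IsFrameFor W (fun k : ℤ => intTranslate k φ))
    (hφ₁ : IsFrameFor V (fun k : ℤ => intTranslate k φ₁))
    (ε : ℝ) (hε₀ : 0 ≤ ε) (hε₁ : ε < 1)
    (ψ : L2R) (hψ : ψ ∈ V)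
    (H : ℝ → ℂ) (hHper : Function.Periodic H 1)
    (hH : MemLp H 2 (volume.restrict (Set.Ioo (0 : ℝ) 1)))
    (hψH : ((𝓕 ψ : L2R) : ℝ → ℂ) =ᵐ[volume] fun γ => H γ * (𝓕 φ₁ : L2R) γ)
    (hdual : IsApproxObliqueDual W V hW hV hWV ε
      (fun k : ℤ => intTranslate k φ) (fun k : ℤ => intTranslate k ψ)) :
    ∀ᵐ γ ∂(volume.restrict (Set.Icc (0 : ℝ) 1)), periodization φ γ ≠ 0 →
      Summable (fun n : ℤ => (𝓕 φ : L2R) (γ + n) * conj ((𝓕 φ₁ : L2R) (γ + n))) ∧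
      bracket φ φ₁ γ ≠ 0 ∧
      ‖conj (H γ) - 1 / bracket φ φ₁ γ‖ ≤ ε / ‖bracket φ φ₁ γ‖ := by

  obtain ⟨hf, hg, hor⟩ := hdual
  have hB := hf.isBessel hW
  have hB' := hg.isBessel hV
  have key : ∀ᵐ γ ∂periodMeasure, periodization φ γ ≠ 0 → ‖1 - bracket φ ψ γ‖ ≤ ε := by
    rcases hor with h | h
    · exact ae_norm_one_sub_bracket_le hW hf.1 hB hB'
        (fun w hw => obliqueProjection_apply_of_mem hW hWV hw) hε₀ h
    -- Taking adjoints preserves the norm and turns T_ψ T_φ^* into T_φ T_ψ^*, which reduces the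
    -- second alternative to the first.
    · refine ae_norm_one_sub_bracket_le hW hf.1 hB hB'
        (fun w hw => adjoint_obliqueProjection_apply_of_mem hV
          (isCompl_orthogonal_symm hW hV hWV) hw) hε₀ ?_
      rw [← LinearIsometryEquiv.norm_map ContinuousLinearMap.adjoint] at h
      rwa [map_sub, ContinuousLinearMap.adjoint_comp, synthesisOp,
        ContinuousLinearMap.adjoint_adjoint] at h
  rw [← restrict_Ioc_eq_restrict_Icc]
  filter_upwards [key, ae_summable_bracket φ φ₁, bracket_of_fourier_eq_mul hHper hψH]
    with γ h1 h2 h3 hne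
  have h4 : bracket φ ψ γ = conj (H γ) * bracket φ φ₁ γ := by
    rw [← conj_bracket, h3, map_mul, conj_bracket]
  have h5 := h1 hne
  rw [h4] at h5
  -- A zero of [φ, φ₁] would turn the estimate into 1 ≤ ε.
  have hb : bracket φ φ₁ γ ≠ 0 := fun h0 => by
    rw [h0, mul_zero, sub_zero, norm_one] at h5
    exact hε₁.not_ge h5
  refine ⟨h2, hb, ?_⟩
  rw [le_div_iff₀ (norm_pos_iff.2 hb), ← norm_mul, sub_mul, one_div, inv_mul_cancel₀ hb,
    norm_sub_rev]
  exact h5
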